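/- For $n\ge 1$ write vectors of the phase space $\mathbb{R}^{2n}$ as $z=(q_1,p_1,\ldots,q_n,p_n)^\top$ and let $J_{2n}$ be the block diagonal matrix with $n$ diagonal blocks $\begin{pmatrix}0&1\\-1&0\end{pmatrix}$. A ($2n\times 2n$) beam matrix is a real symmetric positive definite matrix $\Sigma=\langle (z-\langle z\rangle)(z-\langle z\rangle)^\top\rangle$, the covariance matrix of a probability distribution on phase space with finite second moments. Its projected emittances are $\sqrt{\det\Sigma_{mm}}$, $m=1,\ldots,n$, where $\Sigma_{mm}$ is the $m$-th diagonal $2\times 2$ block of $\Sigma$ (the one belonging to $(q_m,p_m)$). Its eigenemittances are the positive numbers $\epsilon_1,\ldots,\epsilon_n$ for which the complex eigenvalues of $\Sigma J_{2n}$, counted with multiplicity, are $\pm i\epsilon_1,\ldots,\pm i\epsilon_n$. Proposition 4 (three degrees of freedom). Let $\varepsilon_1,\varepsilon_2,\varepsilon_3$ and $\epsilon_{min}\le\epsilon_{mid}\le\epsilon_{max}$ be positive real numbers. There is a $6\times 6$ beam matrix $\Sigma$ whose projected emittances are $\varepsilon_1,\varepsilon_2,\varepsilon_3$ and whose eigenemittances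 are $\epsilon_{min},\epsilon_{mid},\epsilon_{max}$ if and only if the following inequalities hold: $$ \begin{array}{rcl} \varepsilon_1+\varepsilon_2-\varepsilon_3&\ge&\epsilon_{min}+\epsilon_{mid}-\epsilon_{max},\\ \varepsilon_1-\varepsilon_2+\varepsilon_3&\ge&\epsilon_{min}+\epsilon_{mid}-\epsilon_{max},\\ -\varepsilon_1+\varepsilon_2+\varepsilon_3&\ge&\epsilon_{min}+\epsilon_{mid}-\epsilon_{max},\\ \varepsilon_1+\varepsilon_2+\varepsilon_3&\ge&\epsilon_{min}+\epsilon_{mid}+\epsilon_{max},\\ \min(\varepsilon_1,\varepsilon_2,\varepsilon_3)&\ge&\epsilon_{min}. \end{array} $$ -/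

import Mathlib

open Matrix MeasureTheory ProbabilityTheory
open scoped Kronecker

noncomputable section

/-- Index set of the phase space coordinates `(q₁, p₁, …, qₙ, pₙ)`: the index `(m, 0)` is the
coordinate `q` and `(m, 1)` is the momentum `p` of the `m`-th degree of freedom. -/
abbrev PhaseIndex (n : ℕ) : Type := Fin n × Fin 2

/-- The symplectic unit matrix `J = diag(J₂, …, J₂)` with `n` diagonal blocks
`J₂ = !![0, 1; -1, 0]`. -/
def symplecticUnit (n : ℕ) : Matrix (PhaseIndex n) (PhaseIndex n) ℝ :=
  (1 : Matrix (Fin n) (Fin n) ℝ) ⊗ₖ !![0, 1; -1, 0]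

/-- `S` is a (nondegenerate) beam matrix: it is positive definite, and it is the covariance matrix
`⟨(z - ⟨z⟩) (z - ⟨z⟩)ᵀ⟩` of some distribution of particles in phase space (with finite
second moments). -/
def IsBeamMatrix {n : ℕ} (S : Matrix (PhaseIndex n) (PhaseIndex n) ℝ) : Prop :=
  S.PosDef ∧
    ∃ μ : Measure (PhaseIndex n → ℝ), IsProbabilityMeasure μ ∧
      (∀ i, MemLp (fun z : PhaseIndex n → ℝ => z i) 2 μ) ∧
      ∀ i j, S i j = covariance (fun z : PhaseIndex n → ℝ => z i) (fun z => z j) μ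

/-- The `2 × 2` block of `S` in position `(m, k)`. -/
def beamBlock {n : ℕ} (S : Matrix (PhaseIndex n) (PhaseIndex n) ℝ) (m k : Fin n) :
    Matrix (Fin 2) (Fin 2) ℝ :=
  Matrix.of fun a b => S (m, a) (k, b)

/-- The `m`-th projected emittance: the square root of the determinant of the `m`-th diagonal
`2 × 2` block. -/
def projectedEmittance {n : ℕ} (S : Matrix (PhaseIndex n) (PhaseIndex n) ℝ) (m : Fin n) : ℝ :=
  Real.sqrt (beamBlock S m m).det

/-- The numbers `e₁, …, eₙ` are the eigenemittances of `S`: they are positive, and the complex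
eigenvalues of `S J`, counted with algebraic multiplicity, are `±i e₁, …, ±i eₙ`. -/
def IsEigenemittances {n : ℕ} (S : Matrix (PhaseIndex n) (PhaseIndex n) ℝ) (e : Fin n → ℝ) :
    Prop :=
  (∀ m, 0 < e m) ∧
    ((S * symplecticUnit n).map (algebraMap ℝ ℂ)).charpoly.roots =
      ∑ m, ({Complex.I * (e m : ℂ), -(Complex.I * (e m : ℂ))} : Multiset ℂ)

end

/-!
The proof rests on real polar decomposition (necessity) and on two-mode symplectic mixing
(sufficiency).

*Necessity* holds for any number `n` of degrees of freedom. A local symplectic change of variables,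
which changes neither the emittances nor the eigenemittances, turns each diagonal block of `S` into
`ε_m • 1`, so that `tr S = 2 ∑ ε_m`. Write `S = G Gᵀ`. The skew matrix `A = Gᵀ J G` is similar to
`S J`, and it has a polar decomposition `A = O R = R O` with `O` an orthogonal complex structure and
`R` positive definite, whose eigenvalues are the eigenemittances, each counted twice
(`exists_polar`). The matrix `N = G + J G O` is twice the part of `G` that is
antilinear for the complex structures `O` and `J`, and `tr (Nᵀ N) = 2 (tr S - tr R) =
4 (∑ ε_m - ∑ e_m)`; being nonnegative, this gives the inequality between the sums. For the
inequalities with one negative sign (`block_le_of_polar`), let `g = Gᵀ q` and `h = Gᵀ p` for the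
coordinate vectors `q`, `p` of the `m`-th degree of freedom. Because the block is a multiple of the
identity, `x = g - O h` and `y = g + O h` span two orthogonal complex lines. The trace of `Nᵀ N` is
at least its trace on these two lines. On the first, the rows `q` and `p` of `N` contribute
`2 |x|²`. On the second, the linear part `M = G - J G O`, which satisfies `Mᵀ M - Nᵀ N = 4 R`, gives
at least `2 |y|² - 8 e_max`. As `|x|² + |y|² = 4 ε_m`, this yields
`2 (ε_m - e_max) ≤ ∑ ε_k - ∑ e_k`. Finally `e_min ≤ ε_m` is the Cauchy-Schwarz inequality
(`le_block_of_polar`).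

*Sufficiency.* It is enough to look at matrices without correlation between positions and momenta:
`Q = mᵀ D m` for the positions and `P = kᵀ D k` for the momenta, with `D = diag(e)` and `mᵀ k = 1`
(`Realizable`). For two degrees of freedom, `(a₁, a₂)` can be turned into `(b₁, b₂)` as soon as
`a₁ + a₂ ≤ b₁ + b₂` and `|b₁ - b₂| ≤ |a₁ - a₂|` (`exists_two_mode`). Two such steps, the second one
mixing an already mixed degree of freedom with the one left out by the first, reach every triple of
emittances allowed by the inequalities (`realizable_of_ordered`). Every positive definite matrix is
the covariance of a Gaussian measure.
-/

/-! ### Spectra and the polar decomposition of skew matrices -/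

theorem exists_orthogonal_diagonalization {ι : Type*} [Fintype ι] [DecidableEq ι]
    {B : Matrix ι ι ℝ} (hB : B.IsHermitian) :
    ∃ (U : Matrix ι ι ℝ) (d : ι → ℝ), U * Uᵀ = 1 ∧ Uᵀ * U = 1 ∧ B = U * diagonal d * Uᵀ := by
  refine ⟨hB.eigenvectorUnitary, hB.eigenvalues, ?_, ?_, ?_⟩
  · simpa [star_eq_conjTranspose] using Unitary.coe_mul_star_self hB.eigenvectorUnitary
  · simpa [star_eq_conjTranspose] using Unitary.coe_star_mul_self hB.eigenvectorUnitary
  · conv_lhs => rw [hB.spectral_theorem]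
    simp [Unitary.conjStarAlgAut_apply, star_eq_conjTranspose]

open Polynomial in
theorem roots_prod_X_sub_C_pairs {K ι : Type*} [Field K] [Fintype ι] (a b : ι → K) :
    (∏ m, ((X - C (a m)) * (X - C (b m)))).roots = ∑ m, ({a m, b m} : Multiset K) := by
  classical
  have hne (m : ι) : (X - C (a m)) * (X - C (b m)) ≠ 0 :=
    mul_ne_zero (X_sub_C_ne_zero _) (X_sub_C_ne_zero _)
  rw [Polynomial.roots_prod _ _ (Finset.prod_ne_zero_iff.mpr fun m _ => hne m)]
  simp only [roots_mul (hne _), roots_X_sub_C, Finset.sum, Multiset.bind, Multiset.join]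
  rfl

open Polynomial in
/-- If the complex eigenvalues of `A` are `±i e_m`, then the eigenvalues of `-A²` are the `e_m²`,
each counted twice. The reason is the factorization `x² + A² = (x - iA) (x + iA)`, which expresses the
characteristic polynomial of `-A²` at `x²` through that of `A` at `±i x`. -/
theorem roots_of_sq_diagonalization {ι : Type*} [Fintype ι] [DecidableEq ι] {n : ℕ}
    {A U : Matrix ι ι ℝ} {d : ι → ℝ} {e : Fin n → ℝ}
    (hU : Uᵀ * U = 1) (hd : -(A * A) = U * diagonal d * Uᵀ)
    (hroots : (A.map (algebraMap ℝ ℂ)).charpoly.roots =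
      ∑ m, ({Complex.I * (e m : ℂ), -(Complex.I * (e m : ℂ))} : Multiset ℂ)) :
    Finset.univ.val.map d = ∑ m, ({e m ^ 2, e m ^ 2} : Multiset ℝ) := by
  set AC := A.map (algebraMap ℝ ℂ) with hAC
  have hcp : AC.charpoly =
      ∏ m, ((X - C (Complex.I * (e m : ℂ))) * (X + C (Complex.I * (e m : ℂ)))) := by
    have hs := IsAlgClosed.splits AC.charpoly
    have := hs.eq_prod_roots_of_monic (charpoly_monic AC)
    rw [this, hroots]
    induction (Finset.univ : Finset (Fin n)) using Finset.induction_on with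
    | empty => simp
    | insert m s hm ih =>
      rw [Finset.sum_insert hm, Finset.prod_insert hm, Multiset.map_add, Multiset.prod_add, ih]
      simp
  have hB : (-(A * A)).charpoly = ∏ i, (X - C (d i)) := by
    rw [hd, charpoly_mul_comm, ← mul_assoc, hU, one_mul, charpoly_diagonal]
  have hBC : (-(AC * AC)).charpoly = ∏ i, (X - C ((d i : ℝ) : ℂ)) := by
    have : -(AC * AC) = (-(A * A)).map (algebraMap ℝ ℂ) := by
      rw [hAC]; ext i j; simp [Matrix.mul_apply]
    rw [this, charpoly_map, hB]
    simp [Polynomial.map_prod]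
  -- Every complex number is a square `x²`, so it suffices to compare the values there.
  have key : ∏ i, (X - C ((d i : ℝ) : ℂ)) =
      ∏ m, ((X - C ((e m : ℂ) ^ 2)) * (X - C ((e m : ℂ) ^ 2))) := by
    refine Polynomial.funext fun y => ?_
    obtain ⟨x, rfl⟩ := IsAlgClosed.exists_pow_nat_eq y (n := 2) (by norm_num)
    rw [← hBC, eval_charpoly]
    have hI : Complex.I * Complex.I = -1 := Complex.I_mul_I
    have h1 : (scalar ι) (x ^ 2) - -(AC * AC) =
        (Complex.I • ((scalar ι) (-(Complex.I * x)) - AC)) *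
          ((-Complex.I) • ((scalar ι) (Complex.I * x) - AC)) := by
      rw [smul_mul_smul_comm]
      have : Complex.I * -Complex.I = 1 := by simp
      rw [this, one_smul]
      have hc := (Matrix.scalar_commute (n := ι) (Complex.I * x) (fun r => Commute.all _ r) AC).eq
      have h2 : (scalar ι) (-(Complex.I * x)) = -(scalar ι) (Complex.I * x) := map_neg _ _
      have h3 : (scalar ι) (Complex.I * x) * (scalar ι) (Complex.I * x) = - (scalar ι) (x ^ 2) := by
        rw [← map_mul, ← map_neg]; congr 1; linear_combination x ^ 2 * hI
      rw [h2]
      have : (-(scalar ι) (Complex.I * x) - AC) * ((scalar ι) (Complex.I * x) - AC) =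
        -((scalar ι) (Complex.I * x) * (scalar ι) (Complex.I * x)) +
          ((scalar ι) (Complex.I * x) * AC - AC * (scalar ι) (Complex.I * x)) + AC * AC := by
        noncomm_ring
      rw [this, h3, hc]; simp
    rw [h1, det_mul, det_smul, det_smul, ← eval_charpoly, ← eval_charpoly, hcp]
    have h4 : Complex.I ^ Fintype.card ι * (-Complex.I) ^ Fintype.card ι = 1 := by
      rw [← mul_pow]; simp
    rw [mul_mul_mul_comm, h4, one_mul, eval_prod, eval_prod, eval_prod, ← Finset.prod_mul_distrib]
    refine Finset.prod_congr rfl fun m _ => ?_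
    simp only [eval_mul, eval_sub, eval_add, eval_X, eval_C]
    linear_combination ((x ^ 2 - (e m : ℂ) ^ 2) ^ 2 * (Complex.I ^ 2 - 1)) * hI
  have keyR : ∏ i, (X - C (d i)) = ∏ m, ((X - C (e m ^ 2)) * (X - C (e m ^ 2))) := by
    refine Polynomial.map_injective (algebraMap ℝ ℂ) (algebraMap ℝ ℂ).injective ?_
    simpa [Polynomial.map_prod] using key
  rw [← roots_prod_X_sub_C_pairs, ← keyR, ← Finset.prod_map_val]
  have := Polynomial.roots_multiset_prod_X_sub_C (Finset.univ.val.map d)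
  rw [Multiset.map_map] at this
  exact this.symm

/-- Polar decomposition of a skew matrix `A` with complex eigenvalues `±i e_m`: the orthogonal
factor `O` is a complex structure, it commutes with the positive factor `R`, and the eigenvalues of `R` are
the `e_m`, each counted twice. The last fact is recorded through the trace of `R` and bounds on its
quadratic form. -/
theorem exists_polar {ι : Type*} [Fintype ι] [DecidableEq ι] {n : ℕ}
    {A : Matrix ι ι ℝ} {e : Fin n → ℝ} {lo hi : ℝ} (hA : Aᵀ = -A) (he : ∀ m, 0 < e m)
    (hlo : ∀ m, lo ≤ e m) (hhi : ∀ m, e m ≤ hi)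
    (hroots : (A.map (algebraMap ℝ ℂ)).charpoly.roots =
      ∑ m, ({Complex.I * (e m : ℂ), -(Complex.I * (e m : ℂ))} : Multiset ℂ)) :
    ∃ O R : Matrix ι ι ℝ, Oᵀ = -O ∧ O * O = -1 ∧ A = O * R ∧ A = R * O ∧
      R.trace = 2 * ∑ m, e m ∧ (∀ v, lo * (v ⬝ᵥ v) ≤ v ⬝ᵥ R *ᵥ v) ∧
      ∀ v, v ⬝ᵥ R *ᵥ v ≤ hi * (v ⬝ᵥ v) := by
  have hB : (-(A * A)).IsHermitian := by
    simp [IsHermitian, transpose_mul, hA]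
  obtain ⟨U, d, hU1, hU2, hd⟩ := exists_orthogonal_diagonalization hB
  have hmult := roots_of_sq_diagonalization hU2 hd hroots
  have hmem (i : ι) : ∃ m, d i = e m ^ 2 := by
    have : d i ∈ Finset.univ.val.map d := Multiset.mem_map_of_mem _ (Finset.mem_univ i)
    rw [hmult, Multiset.mem_sum] at this
    obtain ⟨m, -, hm⟩ := this
    exact ⟨m, by simpa using hm⟩
  set r : ι → ℝ := fun i => √(d i) with hr
  have hmem' (i : ι) : ∃ m, r i = e m := by
    obtain ⟨m, hm⟩ := hmem i
    exact ⟨m, by rw [hr]; simp only [hm]; exact Real.sqrt_sq (he m).le⟩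
  have hrpos (i : ι) : 0 < r i := by obtain ⟨m, hm⟩ := hmem' i; rw [hm]; exact he m
  have hrsq (i : ι) : r i * r i = d i := by
    obtain ⟨m, hm⟩ := hmem i
    exact Real.mul_self_sqrt (by rw [hm]; positivity)
  have hsum : ∑ i, r i = 2 * ∑ m, e m := by
    have h1 := congrArg (fun s => (Multiset.map Real.sqrt s).sum) hmult
    simp only [Multiset.map_map] at h1
    have h2 (s : Finset (Fin n)) : (Multiset.map Real.sqrt (∑ m ∈ s, {e m ^ 2, e m ^ 2})).sum =
        2 * ∑ m ∈ s, e m := by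
      induction s using Finset.induction_on with
      | empty => simp
      | insert m s hm ih =>
        rw [Finset.sum_insert hm, Finset.sum_insert hm, Multiset.map_add, Multiset.sum_add, ih]
        simp [Real.sqrt_sq (he m).le]; ring
    rw [h2] at h1
    exact h1
  -- In the eigenbasis of `-A²`, the matrix `A` commutes with every function of the eigenvalues.
  set A' := Uᵀ * A * U with hA'
  have hAA' : A = U * A' * Uᵀ := by
    rw [hA']; simp only [← mul_assoc, hU1, one_mul]; rw [mul_assoc, hU1, mul_one]
  have hA'2 : A' * A' = -diagonal d := by
    have : A' * A' = Uᵀ * (A * A) * U := by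
      rw [hA']; simp only [mul_assoc]; rw [← mul_assoc U Uᵀ, hU1, one_mul]
    rw [this, ← neg_neg (A * A), hd]
    simp only [Matrix.mul_neg, Matrix.neg_mul, ← mul_assoc, hU2, one_mul]
    rw [mul_assoc, hU2, mul_one]
  have hcommd : A' * diagonal d = diagonal d * A' := by
    have h1 : diagonal d = -(A' * A') := by rw [hA'2, neg_neg]
    rw [h1]; noncomm_ring
  have hcommr : A' * diagonal r = diagonal r * A' := by
    ext i j
    have := congrFun (congrFun hcommd i) j
    rw [mul_diagonal, diagonal_mul] at this ⊢
    by_cases h0 : A' i j = 0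
    · simp [h0]
    · have h3 : d j = d i := by
        apply mul_left_cancel₀ h0; linarith
      simp only [hr, h3]; ring
  have hA'T : A'ᵀ = -A' := by
    rw [hA']; simp [transpose_mul, hA, mul_assoc]
  set rinv : ι → ℝ := fun i => (r i)⁻¹ with hrinv
  have hri : diagonal r * diagonal rinv = 1 := by
    rw [diagonal_mul_diagonal, ← diagonal_one]; congr 1; ext i; exact mul_inv_cancel₀ (hrpos i).ne'
  have hir : diagonal rinv * diagonal r = 1 := by
    rw [diagonal_mul_diagonal, ← diagonal_one]; congr 1; ext i; exact inv_mul_cancel₀ (hrpos i).ne'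
  have hcommi : A' * diagonal rinv = diagonal rinv * A' := by
    calc A' * diagonal rinv = diagonal rinv * (diagonal r * A') * diagonal rinv := by
          rw [← mul_assoc, hir, one_mul]
      _ = diagonal rinv * A' * (diagonal r * diagonal rinv) := by
          rw [← hcommr]; simp only [mul_assoc]
      _ = _ := by rw [hri, mul_one]
  have hconj (X Y : Matrix ι ι ℝ) : (U * X * Uᵀ) * (U * Y * Uᵀ) = U * (X * Y) * Uᵀ := by
    simp only [mul_assoc]; rw [← mul_assoc Uᵀ U, hU2, one_mul]
  have hquad (v : ι → ℝ) (f : ι → ℝ) :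
      v ⬝ᵥ (U * diagonal f * Uᵀ) *ᵥ v = ∑ i, f i * (Uᵀ *ᵥ v) i ^ 2 := by
    rw [← mulVec_mulVec, ← mulVec_mulVec, dotProduct_mulVec, ← mulVec_transpose]
    simp only [dotProduct, mulVec_diagonal]
    exact Finset.sum_congr rfl fun i _ => by ring
  have hnorm (v : ι → ℝ) : v ⬝ᵥ v = ∑ i, (Uᵀ *ᵥ v) i ^ 2 := by
    have := hquad v 1
    simpa [hU1] using this
  refine ⟨U * (A' * diagonal rinv) * Uᵀ, U * diagonal r * Uᵀ, ?_, ?_, ?_, ?_, ?_, ?_, ?_⟩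
  · simp only [transpose_mul, transpose_transpose, diagonal_transpose, hA'T, hcommi]
    rw [← hcommi]
    simp [mul_assoc]
  · rw [hconj]
    have : A' * diagonal rinv * (A' * diagonal rinv) = -1 := by
      nth_rw 1 [hcommi]
      have h5 : diagonal d = diagonal r * diagonal r := by
        rw [diagonal_mul_diagonal]; congr 1; ext i; exact (hrsq i).symm
      calc diagonal rinv * A' * (A' * diagonal rinv)
          _ = diagonal rinv * (A' * A') * diagonal rinv := by
            simp only [mul_assoc]
          _ = -((diagonal rinv * diagonal r) * (diagonal r * diagonal rinv)) := by
            rw [hA'2, h5]; simp only [Matrix.mul_neg, Matrix.neg_mul, mul_assoc]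
          _ = -1 := by rw [hri, hir, one_mul]
    rw [this]; simp [hU1]
  · rw [hconj, mul_assoc A', hir, mul_one]; exact hAA'
  · rw [hconj, hcommi, ← mul_assoc (diagonal r), hri, one_mul]; exact hAA'
  · rw [trace_mul_comm, ← mul_assoc, hU2, one_mul, trace_diagonal, hsum]
  · intro v
    rw [hquad, hnorm, Finset.mul_sum]
    refine Finset.sum_le_sum fun i _ => ?_
    obtain ⟨m, hm⟩ := hmem' i
    exact mul_le_mul_of_nonneg_right (hm ▸ hlo m) (sq_nonneg _)
  · intro v
    rw [hquad, hnorm, Finset.mul_sum]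
    refine Finset.sum_le_sum fun i _ => ?_
    obtain ⟨m, hm⟩ := hmem' i
    exact mul_le_mul_of_nonneg_right (hm ▸ hhi m) (sq_nonneg _)

/-! ### Necessity: inequalities from the polar decomposition -/

/-- Bessel's inequality for an orthogonal family of vectors of norm at most one. Zero vectors are
allowed, so that no case distinction is needed when a vector to be normalized vanishes. -/
theorem sum_sq_dotProduct_le {ι κ : Type*} [Fintype ι] [Fintype κ] (c : κ → ι → ℝ)
    (horth : ∀ k l, k ≠ l → c k ⬝ᵥ c l = 0) (hnorm : ∀ k, c k ⬝ᵥ c k ≤ 1) (z : ι → ℝ) :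
    ∑ k, (z ⬝ᵥ c k) ^ 2 ≤ z ⬝ᵥ z := by
  classical
  set t : κ → ℝ := fun k => z ⬝ᵥ c k with ht
  set w : ι → ℝ := ∑ k, t k • c k with hw
  have hzw : z ⬝ᵥ w = ∑ k, t k ^ 2 := by
    rw [hw, dotProduct_sum]
    exact Finset.sum_congr rfl fun k _ => by rw [dotProduct_smul, smul_eq_mul, sq]
  have hww : w ⬝ᵥ w ≤ ∑ k, t k ^ 2 := by
    have : w ⬝ᵥ w = ∑ k, t k ^ 2 * (c k ⬝ᵥ c k) := by
      rw [hw, sum_dotProduct]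
      refine Finset.sum_congr rfl fun k _ => ?_
      rw [dotProduct_sum, Finset.sum_eq_single k]
      · simp; ring
      · intro l _ hl; simp [horth k l hl.symm]
      · simp
    rw [this]
    exact Finset.sum_le_sum fun k _ => mul_le_of_le_one_right (sq_nonneg _) (hnorm k)
  have h0 : 0 ≤ (z - w) ⬝ᵥ (z - w) := Finset.sum_nonneg fun i _ => mul_self_nonneg _
  simp only [sub_dotProduct, dotProduct_sub, dotProduct_comm w z] at h0
  linarith

theorem sum_mulVec_le_trace {ι κ : Type*} [Fintype ι] [Fintype κ] (N : Matrix ι ι ℝ)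
    (c : κ → ι → ℝ) (horth : ∀ k l, k ≠ l → c k ⬝ᵥ c l = 0) (hnorm : ∀ k, c k ⬝ᵥ c k ≤ 1) :
    ∑ k, (N *ᵥ c k) ⬝ᵥ (N *ᵥ c k) ≤ (Nᵀ * N).trace := by
  have h1 : (Nᵀ * N).trace = ∑ i, N i ⬝ᵥ N i := by
    simp only [trace, diag, Matrix.mul_apply, transpose_apply, dotProduct]
    exact Finset.sum_comm
  have h2 : ∑ k, (N *ᵥ c k) ⬝ᵥ (N *ᵥ c k) = ∑ i, ∑ k, (N i ⬝ᵥ c k) ^ 2 := by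
    rw [Finset.sum_comm]
    exact Finset.sum_congr rfl fun k _ => Finset.sum_congr rfl fun i _ => by
      simp only [mulVec]; ring
  rw [h1, h2]
  exact Finset.sum_le_sum fun i _ => sum_sq_dotProduct_le c horth hnorm _

theorem dotProduct_mulVec_of_skew {ι : Type*} [Fintype ι] {O : Matrix ι ι ℝ} (hO : Oᵀ = -O)
    (u v : ι → ℝ) : u ⬝ᵥ O *ᵥ v = -(O *ᵥ u ⬝ᵥ v) := by
  rw [dotProduct_mulVec, ← mulVec_transpose, hO, neg_mulVec, neg_dotProduct]

/-- Gram matrix of `G + s J G O`. For `s = 1` (`s = -1`) this matrix is twice the part of `G` that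
is antilinear (linear) with respect to the complex structures `O` on the source and `J` on the
target. -/
theorem antilinear_part_gram {ι : Type*} [Fintype ι] [DecidableEq ι] {J G O R : Matrix ι ι ℝ}
    (hJT : Jᵀ = -J) (hJ2 : J * J = -1) (hOT : Oᵀ = -O) (hO2 : O * O = -1)
    (hOR : Gᵀ * J * G = O * R) (hRO : Gᵀ * J * G = R * O) (s : ℝ) :
    (G + s • (J * G * O))ᵀ * (G + s • (J * G * O)) =
      Gᵀ * G - s ^ 2 • (O * (Gᵀ * G) * O) - (2 * s) • R := by
  have h1 : Gᵀ * (J * G * O) = -R := by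
    rw [← mul_assoc, ← mul_assoc, hRO, mul_assoc, hO2]; simp
  have h2 : (J * G * O)ᵀ * G = -R := by
    simp only [transpose_mul, hJT, hOT]
    have : -O * (Gᵀ * -J) * G = O * (Gᵀ * J * G) := by noncomm_ring
    rw [this, hOR, ← mul_assoc, hO2]; simp
  have h3 : (J * G * O)ᵀ * (J * G * O) = -(O * (Gᵀ * G) * O) := by
    simp only [transpose_mul, hJT, hOT]
    have : -O * (Gᵀ * -J) * (J * G * O) = O * Gᵀ * (J * J) * G * O := by noncomm_ring
    rw [this, hJ2]; noncomm_ring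
  rw [transpose_add, transpose_smul, add_mul, mul_add, mul_add]
  simp only [smul_mul_assoc, mul_smul_comm, h1, h2, h3, smul_neg, smul_smul]
  module

theorem trace_antilinear_part {ι : Type*} [Fintype ι] [DecidableEq ι] {J G O R : Matrix ι ι ℝ}
    (hJT : Jᵀ = -J) (hJ2 : J * J = -1) (hOT : Oᵀ = -O) (hO2 : O * O = -1)
    (hOR : Gᵀ * J * G = O * R) (hRO : Gᵀ * J * G = R * O) :
    ((G + J * G * O)ᵀ * (G + J * G * O)).trace = 2 * ((G * Gᵀ).trace - R.trace) := by
  have h := antilinear_part_gram hJT hJ2 hOT hO2 hOR hRO 1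
  simp only [one_smul, one_pow, mul_one] at h
  rw [h, trace_sub, trace_sub, trace_mul_comm (O * (Gᵀ * G)) O, ← mul_assoc O O, hO2, trace_smul,
    trace_mul_comm G]
  simp; ring

theorem trace_polar_le {ι : Type*} [Fintype ι] [DecidableEq ι] {J G O R : Matrix ι ι ℝ}
    (hJT : Jᵀ = -J) (hJ2 : J * J = -1) (hOT : Oᵀ = -O) (hO2 : O * O = -1)
    (hOR : Gᵀ * J * G = O * R) (hRO : Gᵀ * J * G = R * O) :
    R.trace ≤ (G * Gᵀ).trace := by
  have h := trace_antilinear_part hJT hJ2 hOT hO2 hOR hRO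
  -- The empty family: the trace of a Gram matrix is nonnegative.
  have := sum_mulVec_le_trace (κ := Empty) (G + J * G * O) nofun nofun nofun
  rw [h] at this
  simp at this
  exact this

/-- A scalar `s` that normalizes a vector of squared norm `X`; for `X = 0` any `s` will do. -/
theorem exists_normalizing_scalar {X : ℝ} (hX : 0 ≤ X) :
    ∃ s : ℝ, s ^ 2 * X ≤ 1 ∧ s ^ 2 * X ^ 2 = X := by
  rcases hX.eq_or_lt with rfl | h
  · exact ⟨0, by simp, by simp⟩
  · refine ⟨(√X)⁻¹, ?_, ?_⟩ <;> rw [inv_pow, Real.sq_sqrt hX]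
    · exact (inv_mul_cancel₀ h.ne').le
    · field_simp

theorem two_coord_le {ι : Type*} [Fintype ι] {q p : ι → ℝ}
    (hq : q ⬝ᵥ q = 1) (hp : p ⬝ᵥ p = 1) (hqp : q ⬝ᵥ p = 0) (z : ι → ℝ) :
    (q ⬝ᵥ z) ^ 2 + (p ⬝ᵥ z) ^ 2 ≤ z ⬝ᵥ z := by
  have := sum_sq_dotProduct_le ![q, p] (by
    intro k l hkl
    fin_cases k <;> fin_cases l <;> simp_all [dotProduct_comm p q]) (by
    intro k; fin_cases k <;> simp [hq, hp]) z
  simpa [Fin.sum_univ_two, dotProduct_comm z] using this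

/-- A block `ε • 1` of `G Gᵀ` on a canonical pair `q, p` exceeds the largest eigenvalue of `R` by at
most a quarter of `tr (G Gᵀ) - tr R`. The trace of the Gram matrix of the antilinear part of `G` is
bounded below by its values on the normalized orthogonal vectors `x`, `O x`, `y`, `O y`. -/
theorem block_le_of_polar {ι : Type*} [Fintype ι] [DecidableEq ι] {J G O R : Matrix ι ι ℝ}
    (hJT : Jᵀ = -J) (hJ2 : J * J = -1) (hOT : Oᵀ = -O) (hO2 : O * O = -1)
    (hOR : Gᵀ * J * G = O * R) (hRO : Gᵀ * J * G = R * O) {hi : ℝ} (hhi0 : 0 ≤ hi)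
    (hhi : ∀ v, v ⬝ᵥ R *ᵥ v ≤ hi * (v ⬝ᵥ v)) {q p : ι → ℝ}
    (hq : q ⬝ᵥ q = 1) (hp : p ⬝ᵥ p = 1) (hqp : q ⬝ᵥ p = 0) (hJp : J *ᵥ p = q)
    (hJq : J *ᵥ q = -p) {ε : ℝ} (hgg : (Gᵀ *ᵥ q) ⬝ᵥ (Gᵀ *ᵥ q) = ε)
    (hhh : (Gᵀ *ᵥ p) ⬝ᵥ (Gᵀ *ᵥ p) = ε) (hgh : (Gᵀ *ᵥ q) ⬝ᵥ (Gᵀ *ᵥ p) = 0) :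
    4 * (ε - hi) ≤ (G * Gᵀ).trace - R.trace := by
  set g := Gᵀ *ᵥ q with hg
  set h := Gᵀ *ᵥ p with hh
  set N := G + J * G * O with hN
  set M := G - J * G * O with hM
  have hMN (v : ι → ℝ) :
      (N *ᵥ v) ⬝ᵥ (N *ᵥ v) = (M *ᵥ v) ⬝ᵥ (M *ᵥ v) - 4 * (v ⬝ᵥ R *ᵥ v) := by
    have e1 := antilinear_part_gram hJT hJ2 hOT hO2 hOR hRO 1
    have e2 := antilinear_part_gram hJT hJ2 hOT hO2 hOR hRO (-1)
    have e3 : Nᵀ * N = Mᵀ * M - (4 : ℝ) • R := by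
      have hM' : M = G + (-1 : ℝ) • (J * G * O) := by rw [hM]; module
      have hN' : N = G + (1 : ℝ) • (J * G * O) := by rw [hN]; module
      rw [hM', hN', e1, e2]; module
    have e4 (K : Matrix ι ι ℝ) : (K *ᵥ v) ⬝ᵥ (K *ᵥ v) = v ⬝ᵥ (Kᵀ * K) *ᵥ v := by
      rw [← mulVec_mulVec, dotProduct_mulVec v, ← mulVec_transpose, transpose_transpose]
    rw [e4, e4, e3, sub_mulVec, dotProduct_sub, smul_mulVec, dotProduct_smul, smul_eq_mul]
  have hG (u v : ι → ℝ) : u ⬝ᵥ G *ᵥ v = Gᵀ *ᵥ u ⬝ᵥ v := by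
    rw [dotProduct_mulVec, ← mulVec_transpose]
  have hO (u v : ι → ℝ) : u ⬝ᵥ O *ᵥ v = -(O *ᵥ u ⬝ᵥ v) := dotProduct_mulVec_of_skew hOT u v
  have hOO (u v : ι → ℝ) : O *ᵥ u ⬝ᵥ O *ᵥ v = u ⬝ᵥ v := by
    rw [hO, mulVec_mulVec, hO2, neg_mulVec, one_mulVec,
      neg_dotProduct, neg_neg]
  have hOO' (v : ι → ℝ) : O *ᵥ (O *ᵥ v) = -v := by
    rw [mulVec_mulVec, hO2, neg_mulVec, one_mulVec]
  have hOself (u : ι → ℝ) : O *ᵥ u ⬝ᵥ u = 0 := by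
    have := hO u u
    rw [dotProduct_comm] at this
    linarith
  have hJqw (w : ι → ℝ) : q ⬝ᵥ J *ᵥ w = p ⬝ᵥ w := by
    rw [dotProduct_mulVec_of_skew hJT, hJq]; simp
  have hJpw (w : ι → ℝ) : p ⬝ᵥ J *ᵥ w = -(q ⬝ᵥ w) := by
    rw [dotProduct_mulVec_of_skew hJT, hJp]
  set x := g - O *ᵥ h with hx
  set y := g + O *ᵥ h with hy
  have hOx : O *ᵥ x = O *ᵥ g + h := by rw [hx, mulVec_sub, hOO']; simp
  have hOy : O *ᵥ y = O *ᵥ g - h := by rw [hy, mulVec_add, hOO']; simp [sub_eq_add_neg]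
  have hJG (v : ι → ℝ) : (J * G * O) *ᵥ v = J *ᵥ (G *ᵥ (O *ᵥ v)) := by
    simp [mulVec_mulVec, mul_assoc]
  have hqN (v : ι → ℝ) : q ⬝ᵥ N *ᵥ v = x ⬝ᵥ v := by
    rw [hN, add_mulVec, hJG, dotProduct_add, hJqw, hG, hG, ← hg, ← hh, hO, hx, sub_dotProduct]; ring
  have hpN (v : ι → ℝ) : p ⬝ᵥ N *ᵥ v = O *ᵥ x ⬝ᵥ v := by
    rw [hN, add_mulVec, hJG, dotProduct_add, hJpw, hG, hG, ← hg, ← hh, hO, hOx,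
      add_dotProduct]; ring
  have hqM (v : ι → ℝ) : q ⬝ᵥ M *ᵥ v = y ⬝ᵥ v := by
    rw [hM, sub_mulVec, hJG, dotProduct_sub, hJqw, hG, hG, ← hg, ← hh, hO, hy, add_dotProduct]; ring
  have hpM (v : ι → ℝ) : p ⬝ᵥ M *ᵥ v = -(O *ᵥ y ⬝ᵥ v) := by
    rw [hM, sub_mulVec, hJG, dotProduct_sub, hJpw, hG, hG, ← hg, ← hh, hO, hOy,
      sub_dotProduct]; ring
  have hOgg := hOself g
  have hOhh := hOself h
  have hgh' : h ⬝ᵥ g = 0 := by rw [dotProduct_comm]; exact hgh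
  have hgOh : g ⬝ᵥ O *ᵥ h = -(O *ᵥ g ⬝ᵥ h) := hO g h
  have hOhg : O *ᵥ h ⬝ᵥ g = -(O *ᵥ g ⬝ᵥ h) := by rw [dotProduct_comm]; exact hO g h
  have hxy : x ⬝ᵥ y = 0 := by
    rw [hx, hy]; simp only [sub_dotProduct, dotProduct_add, hOO]; linarith
  have hOxy : O *ᵥ x ⬝ᵥ y = 0 := by
    rw [hOx, hy]; simp only [add_dotProduct, dotProduct_add, hOO]
    have := hO h h
    linarith
  set X := x ⬝ᵥ x with hX
  set Y := y ⬝ᵥ y with hY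
  have hXY : X + Y = 4 * ε := by
    rw [hX, hY, hx, hy]
    simp only [sub_dotProduct, add_dotProduct, dotProduct_sub, dotProduct_add, hOO]
    linarith
  have hX0 : 0 ≤ X := Finset.sum_nonneg fun i _ => mul_self_nonneg _
  have hY0 : 0 ≤ Y := Finset.sum_nonneg fun i _ => mul_self_nonneg _
  obtain ⟨s, hs1, hs2⟩ := exists_normalizing_scalar hX0
  obtain ⟨t, ht1, ht2⟩ := exists_normalizing_scalar hY0
  have hyx : y ⬝ᵥ x = 0 := by rw [dotProduct_comm]; exact hxy
  have hyOx : y ⬝ᵥ O *ᵥ x = 0 := by rw [dotProduct_comm]; exact hOxy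
  have hOyx : O *ᵥ y ⬝ᵥ x = 0 := by have := hO y x; linarith
  have hxOy : x ⬝ᵥ O *ᵥ y = 0 := by rw [dotProduct_comm]; exact hOyx
  have hOxx := hOself x
  have hOyy := hOself y
  have hxOx : x ⬝ᵥ O *ᵥ x = 0 := by rw [dotProduct_comm]; exact hOself x
  have hyOy : y ⬝ᵥ O *ᵥ y = 0 := by rw [dotProduct_comm]; exact hOself y
  -- The values of `N` on `x` and `O x` are seen by its own rows `q` and `p`; those on `y` and `O y`
  -- by the rows of `M`, at the cost of a term in `R`.
  have htr := sum_mulVec_le_trace N ![s • x, s • O *ᵥ x, t • y, t • O *ᵥ y] (by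
    intro k l hkl
    fin_cases k <;> fin_cases l <;> first
      | exact absurd rfl hkl
      | simp [hxy, hOxy, hyx, hyOx, hOyx, hxOy, hOxx, hOyy, hxOx, hyOy, hOO]) (by
    intro k
    fin_cases k <;> simp [hOO, ← hX, ← hY] <;> linarith)
  have hN_x : X ≤ (N *ᵥ (s • x)) ⬝ᵥ (N *ᵥ (s • x)) := by
    have := two_coord_le hq hp hqp (N *ᵥ (s • x))
    rw [hqN, hpN, dotProduct_smul, dotProduct_smul, hOxx, ← hX] at this
    simp only [smul_eq_mul] at this
    linarith
  have hN_Ox : X ≤ (N *ᵥ (s • O *ᵥ x)) ⬝ᵥ (N *ᵥ (s • O *ᵥ x)) := by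
    have := two_coord_le hq hp hqp (N *ᵥ (s • O *ᵥ x))
    rw [hqN, hpN, dotProduct_smul, dotProduct_smul, hOO, hxOx, ← hX] at this
    simp only [smul_eq_mul] at this
    linarith
  have hN_y : Y - 4 * hi ≤ (N *ᵥ (t • y)) ⬝ᵥ (N *ᵥ (t • y)) := by
    have h1 := two_coord_le hq hp hqp (M *ᵥ (t • y))
    rw [hqM, hpM, dotProduct_smul, dotProduct_smul, hOyy, ← hY] at h1
    have h2 := hhi (t • y)
    have h3 : (t • y) ⬝ᵥ (t • y) = t ^ 2 * Y := by simp [← hY]; ring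
    have h4 := mul_le_mul_of_nonneg_left ht1 hhi0
    rw [hMN]
    simp only [smul_eq_mul] at h1
    rw [h3] at h2
    linarith
  have hN_Oy : Y - 4 * hi ≤ (N *ᵥ (t • O *ᵥ y)) ⬝ᵥ (N *ᵥ (t • O *ᵥ y)) := by
    have h1 := two_coord_le hq hp hqp (M *ᵥ (t • O *ᵥ y))
    rw [hqM, hpM, dotProduct_smul, dotProduct_smul, hOO, hyOy, ← hY] at h1
    have h2 := hhi (t • O *ᵥ y)
    have h3 : (t • O *ᵥ y) ⬝ᵥ (t • O *ᵥ y) = t ^ 2 * Y := by simp [hOO, ← hY]; ring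
    have h4 := mul_le_mul_of_nonneg_left ht1 hhi0
    rw [hMN]
    simp only [smul_eq_mul] at h1
    rw [h3] at h2
    linarith
  rw [Fin.sum_univ_four, trace_antilinear_part hJT hJ2 hOT hO2 hOR hRO] at htr
  simp only [Matrix.cons_val] at htr
  linarith

/-- A block `ε • 1` of `G Gᵀ` on a canonical pair `q, p` is at least the smallest eigenvalue of `R`.
With `v = G⁻¹ q` one has `|R v| = |Gᵀ J q| = |Gᵀ p|` and `1 = (Gᵀ q) ⬝ v`; both are combined by the
Cauchy-Schwarz inequality. -/
theorem le_block_of_polar {ι : Type*} [Fintype ι] [DecidableEq ι] {J G O R : Matrix ι ι ℝ}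
    (hOT : Oᵀ = -O) (hO2 : O * O = -1) (hG : IsUnit G)
    (hOR : Gᵀ * J * G = O * R) {lo : ℝ} (hlo0 : 0 < lo)
    (hlo : ∀ v, lo * (v ⬝ᵥ v) ≤ v ⬝ᵥ R *ᵥ v) {q p : ι → ℝ}
    (hq : q ⬝ᵥ q = 1) (hJq : J *ᵥ q = -p) {ε : ℝ} (hgg : (Gᵀ *ᵥ q) ⬝ᵥ (Gᵀ *ᵥ q) = ε)
    (hhh : (Gᵀ *ᵥ p) ⬝ᵥ (Gᵀ *ᵥ p) = ε) : lo ≤ ε := by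
  have cs (a b : ι → ℝ) : (a ⬝ᵥ b) ^ 2 ≤ (a ⬝ᵥ a) * (b ⬝ᵥ b) := by
    have := Finset.sum_mul_sq_le_sq_mul_sq Finset.univ a b
    simpa [dotProduct, sq] using this
  obtain ⟨Ginv, hGi⟩ := hG.exists_right_inv
  set v := Ginv *ᵥ q with hv
  have hGv : G *ᵥ v = q := by rw [hv, mulVec_mulVec, hGi, one_mulVec]
  have hOO (u v : ι → ℝ) : O *ᵥ u ⬝ᵥ O *ᵥ v = u ⬝ᵥ v := by
    rw [dotProduct_mulVec_of_skew hOT, mulVec_mulVec, hO2, neg_mulVec, one_mulVec,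
      neg_dotProduct, neg_neg]
  have hRv : (R *ᵥ v) ⬝ᵥ (R *ᵥ v) = ε := by
    rw [← hOO, mulVec_mulVec, ← hOR, ← mulVec_mulVec, ← mulVec_mulVec, hGv, hJq, mulVec_neg]
    simpa using hhh
  have hε : 0 ≤ ε := by rw [← hgg]; exact Finset.sum_nonneg fun i _ => mul_self_nonneg _
  have h1 : 1 ≤ ε * (v ⬝ᵥ v) := by
    have := cs (Gᵀ *ᵥ q) v
    rw [hgg] at this
    have h2 : (Gᵀ *ᵥ q) ⬝ᵥ v = 1 := by
      rw [mulVec_transpose, ← dotProduct_mulVec, hGv, hq]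
    rw [h2] at this; linarith
  have h2 := cs v (R *ᵥ v)
  rw [hRv] at h2
  have h3 := hlo v
  set V := v ⬝ᵥ v
  have hV : 0 < V := by
    by_contra hV
    have := mul_nonpos_of_nonneg_of_nonpos hε (not_lt.mp hV)
    linarith
  -- `lo² V² ≤ V ε` and `1 ≤ ε V` give `lo² ≤ ε²`.
  have h4 : (lo * V) ^ 2 ≤ V * ε := (pow_le_pow_left₀ (by positivity) h3 2).trans h2
  have h5 : lo ^ 2 * V ≤ ε := by
    have : V * (lo ^ 2 * V) ≤ V * ε := by linarith
    exact le_of_mul_le_mul_left this hV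
  have h6 : lo ^ 2 ≤ ε ^ 2 := by nlinarith [sq_nonneg lo, mul_le_mul_of_nonneg_left h5 hε]
  exact (sq_le_sq₀ hlo0.le hε).mp h6

/-! ### Symplectic changes of variables -/

theorem transpose_symplecticUnit (n : ℕ) : (symplecticUnit n)ᵀ = -symplecticUnit n := by
  ext ⟨m, a⟩ ⟨k, b⟩
  fin_cases a <;> fin_cases b <;> simp [symplecticUnit, Matrix.one_apply, eq_comm]

theorem symplecticUnit_mul_self (n : ℕ) : symplecticUnit n * symplecticUnit n = -1 := by
  rw [symplecticUnit, ← mul_kronecker_mul, mul_one]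
  ext ⟨m, a⟩ ⟨k, b⟩
  fin_cases a <;> fin_cases b <;> simp [Matrix.one_apply]

/-- Symplectic congruence preserves the eigenemittances. -/
theorem charpoly_symplectic_congr {n : ℕ} {M : Matrix (PhaseIndex n) (PhaseIndex n) ℝ}
    (hM : M * symplecticUnit n * Mᵀ = symplecticUnit n)
    (S : Matrix (PhaseIndex n) (PhaseIndex n) ℝ) :
    (Mᵀ * S * M * symplecticUnit n).charpoly = (S * symplecticUnit n).charpoly := by
  rw [mul_assoc, mul_assoc, charpoly_mul_comm, mul_assoc, hM]

/-- The block diagonal matrix with the `2 × 2` blocks `L m`, acting on each degree of freedom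
separately. Unlike in `Matrix.blockDiagonal`, the block label is the first component of an index. -/
def localMatrix {n : ℕ} (L : Fin n → Matrix (Fin 2) (Fin 2) ℝ) :
    Matrix (PhaseIndex n) (PhaseIndex n) ℝ :=
  Matrix.of fun i j => if i.1 = j.1 then L i.1 i.2 j.2 else 0

theorem localMatrix_mul {n : ℕ} (L K : Fin n → Matrix (Fin 2) (Fin 2) ℝ) :
    localMatrix L * localMatrix K = localMatrix fun m => L m * K m := by
  ext ⟨m, a⟩ ⟨k, b⟩
  simp only [localMatrix, Matrix.mul_apply, Fintype.sum_prod_type, of_apply]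
  by_cases h : m = k
  · subst h; simp
  · simp [h]

theorem transpose_localMatrix {n : ℕ} (L : Fin n → Matrix (Fin 2) (Fin 2) ℝ) :
    (localMatrix L)ᵀ = localMatrix fun m => (L m)ᵀ := by
  ext ⟨m, a⟩ ⟨k, b⟩
  by_cases h : m = k
  · subst h; simp [localMatrix]
  · simp [localMatrix, h, Ne.symm h]

theorem symplecticUnit_eq_localMatrix (n : ℕ) :
    symplecticUnit n = localMatrix fun _ => !![0, 1; -1, 0] := by
  ext ⟨m, a⟩ ⟨k, b⟩
  simp [symplecticUnit, localMatrix, Matrix.one_apply]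

theorem localMatrix_symplectic {n : ℕ} {L : Fin n → Matrix (Fin 2) (Fin 2) ℝ}
    (hL : ∀ m, (L m).det = 1) :
    localMatrix L * symplecticUnit n * (localMatrix L)ᵀ = symplecticUnit n := by
  rw [symplecticUnit_eq_localMatrix, transpose_localMatrix, localMatrix_mul, localMatrix_mul]
  congr 1; funext m
  have h := hL m
  rw [det_fin_two] at h
  ext a b
  fin_cases a <;> fin_cases b <;> simp [Matrix.mul_apply, Fin.sum_univ_two] <;> linarith

theorem beamBlock_localMatrix_congr {n : ℕ} (L : Fin n → Matrix (Fin 2) (Fin 2) ℝ)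
    (S : Matrix (PhaseIndex n) (PhaseIndex n) ℝ) (m : Fin n) :
    beamBlock ((localMatrix L)ᵀ * S * localMatrix L) m m = (L m)ᵀ * beamBlock S m m * L m := by
  ext a b
  simp only [beamBlock, localMatrix, Matrix.mul_apply, Fintype.sum_prod_type, of_apply,
    transpose_apply, Fin.sum_univ_two]
  simp [ite_mul, mul_ite, Finset.sum_add_distrib]

/-- A positive definite `2 × 2` block becomes a multiple of the identity under a congruence of
determinant one, hence by a symplectic one. -/
theorem exists_normalizing_block {B : Matrix (Fin 2) (Fin 2) ℝ} (hB : B.PosDef) :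
    ∃ L : Matrix (Fin 2) (Fin 2) ℝ, L.det = 1 ∧ Lᵀ * B * L = √B.det • 1 := by
  have hα : 0 < B 0 0 := hB.diag_pos
  have hdet := hB.det_pos
  have hsymm : B 1 0 = B 0 1 := by simpa using hB.isHermitian.apply 0 1
  set ε := √B.det with hε
  have hε0 : 0 < ε := Real.sqrt_pos.mpr hdet
  have hεsq : ε ^ 2 = B 0 0 * B 1 1 - B 0 1 ^ 2 := by
    rw [hε, Real.sq_sqrt hdet.le, det_fin_two, hsymm]; ring
  set s := √(ε / B 0 0) with hs
  have hs0 : 0 < s := Real.sqrt_pos.mpr (by positivity)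
  have hs2 : s ^ 2 = ε / B 0 0 := Real.sq_sqrt (by positivity)
  have hs2' : s ^ 2 * B 0 0 = ε := by rw [hs2]; field_simp
  -- The columns are `e₀` and the direction `B`-orthogonal to it, scaled to equal `B`-norm.
  refine ⟨!![s, -(B 0 1) / (B 0 0 * s); 0, 1 / s], ?_, ?_⟩
  · rw [det_fin_two]; simp; field_simp
  · ext a b
    fin_cases a <;> fin_cases b <;>
      simp [Matrix.mul_apply, Fin.sum_univ_two, hsymm]
    · linarith
    · field_simp; ring
    · field_simp; simp
    · field_simp
      have : ε * (B 0 0 * s ^ 2) = ε ^ 2 := by rw [mul_comm (B 0 0), hs2']; ring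
      nlinarith

theorem exists_eq_mul_transpose {ι : Type*} [Fintype ι] [DecidableEq ι] {S : Matrix ι ι ℝ}
    (hS : S.PosDef) : ∃ G : Matrix ι ι ℝ, IsUnit G ∧ S = G * Gᵀ := by
  obtain ⟨U, d, hU1, hU2, hd⟩ := exists_orthogonal_diagonalization hS.isHermitian
  have hdiag : (diagonal d).PosDef := by
    have h := hS.conjTranspose_mul_mul_same (B := U)
      (mulVec_injective_of_isUnit (IsUnit.of_mul_eq_one _ hU1))
    rw [hd, conjTranspose_eq_transpose_of_trivial] at h
    simp only [mul_assoc, hU2, mul_one] at h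
    rwa [← mul_assoc, hU2, one_mul] at h
  have hpos : ∀ i, 0 < d i := posDef_diagonal_iff.mp hdiag
  have hSG : S = (U * diagonal fun i => √(d i)) * (U * diagonal fun i => √(d i))ᵀ := by
    rw [hd, transpose_mul, diagonal_transpose, mul_assoc (U), mul_assoc (U),
      ← mul_assoc (diagonal fun i => √(d i)), diagonal_mul_diagonal]
    congr 4
    ext i
    exact (Real.mul_self_sqrt (hpos i).le).symm
  refine ⟨_, ?_, hSG⟩
  rw [isUnit_iff_isUnit_det, isUnit_iff_ne_zero]
  intro h0
  have := hS.det_pos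
  rw [hSG, det_mul, h0, zero_mul] at this
  exact this.false

theorem beamBlock_posDef {n : ℕ} {S : Matrix (PhaseIndex n) (PhaseIndex n) ℝ} (hS : S.PosDef)
    (m : Fin n) : (beamBlock S m m).PosDef :=
  hS.submatrix (e := fun a => (m, a)) fun a b h => by simpa using h

/-- The necessary conditions, for any number of degrees of freedom. -/
theorem emittance_inequalities {n : ℕ} {S : Matrix (PhaseIndex n) (PhaseIndex n) ℝ}
    (hS : S.PosDef) {e : Fin n → ℝ} (he : IsEigenemittances S e) {lo hi : ℝ} (hlo0 : 0 < lo)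
    (hlo : ∀ m, lo ≤ e m) (hhi : ∀ m, e m ≤ hi) :
    ∑ m, e m ≤ ∑ m, projectedEmittance S m ∧
      ∀ m, lo ≤ projectedEmittance S m ∧
        2 * (projectedEmittance S m - hi) ≤ ∑ k, projectedEmittance S k - ∑ k, e k := by
  choose L hLdet hL using fun m => exists_normalizing_block (beamBlock_posDef hS m)
  obtain ⟨G₀, hG₀, hSG⟩ := exists_eq_mul_transpose hS
  set J := symplecticUnit n with hJ
  have hJT : Jᵀ = -J := transpose_symplecticUnit n
  have hJ2 : J * J = -1 := symplecticUnit_mul_self n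
  set M := localMatrix L
  set G := Mᵀ * G₀ with hG
  have hMJ : M * J * Mᵀ = J := localMatrix_symplectic hLdet
  have hGG : G * Gᵀ = Mᵀ * S * M := by rw [hG, hSG]; simp [transpose_mul, mul_assoc]
  have hMunit : IsUnit Mᵀ := by
    refine IsUnit.of_mul_eq_one (b := -(J * M * J)) ?_
    have hright : (M * J) * (-(Mᵀ * J)) = 1 := by
      rw [Matrix.mul_neg, ← mul_assoc, hMJ, hJ2, neg_neg]
    have hleft := mul_eq_one_comm.mp hright
    have h2 : Mᵀ * -(J * M * J) = (-(Mᵀ * J) * (M * J)) := by noncomm_ring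
    rw [h2, hleft]
  have hGunit : IsUnit G := hMunit.mul hG₀
  set A := Gᵀ * J * G with hA
  have hAT : Aᵀ = -A := by rw [hA]; simp [transpose_mul, hJT, mul_assoc]
  have hroots : (A.map (algebraMap ℝ ℂ)).charpoly.roots =
      ∑ m, ({Complex.I * (e m : ℂ), -(Complex.I * (e m : ℂ))} : Multiset ℂ) := by
    rw [← he.2, charpoly_map, charpoly_map, ← charpoly_symplectic_congr hMJ, ← hGG, hA, mul_assoc,
      charpoly_mul_comm, mul_assoc, charpoly_mul_comm]
  obtain ⟨O, R, hOT, hO2, hOR, hRO, htr, hRlo, hRhi⟩ := exists_polar hAT he.1 hlo hhi hroots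
  have hblock (m : Fin n) (a b : Fin 2) :
      (G * Gᵀ) (m, a) (m, b) = if a = b then projectedEmittance S m else 0 := by
    have := congrFun (congrFun (beamBlock_localMatrix_congr L S m) a) b
    rw [hL m, ← hGG] at this
    simpa [beamBlock, Matrix.one_apply, projectedEmittance] using this
  have htrS : (G * Gᵀ).trace = 2 * ∑ m, projectedEmittance S m := by
    simp [trace, Fintype.sum_prod_type, hblock, Finset.mul_sum, two_mul, Finset.sum_add_distrib]
  have hgram (i j : PhaseIndex n) :
      (Gᵀ *ᵥ Pi.single i 1) ⬝ᵥ (Gᵀ *ᵥ Pi.single j 1) = (G * Gᵀ) i j := by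
    simp [Matrix.mul_apply, dotProduct]
  have hJp (m : Fin n) : J *ᵥ Pi.single (m, 1) 1 = Pi.single (m, 0) 1 := by
    ext ⟨k, a⟩
    fin_cases a <;> simp [hJ, symplecticUnit, Matrix.one_apply, Pi.single_apply]
  have hJq (m : Fin n) : J *ᵥ Pi.single (m, 0) 1 = -Pi.single (m, 1) 1 := by
    ext ⟨k, a⟩
    fin_cases a <;> simp [hJ, symplecticUnit, Matrix.one_apply, Pi.single_apply]
  refine ⟨?_, fun m => ⟨?_, ?_⟩⟩
  · have := trace_polar_le hJT hJ2 hOT hO2 hOR hRO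
    linarith
  · exact le_block_of_polar hOT hO2 hGunit hOR hlo0 hRlo (by simp) (hJq m)
      (by rw [hgram, hblock, if_pos rfl]) (by rw [hgram, hblock, if_pos rfl])
  · have := block_le_of_polar hJT hJ2 hOT hO2 hOR hRO
      ((he.1 m).le.trans (hhi m)) hRhi (by simp) (by simp) (by simp) (hJp m) (hJq m)
      (by rw [hgram, hblock, if_pos rfl]) (by rw [hgram, hblock, if_pos rfl])
      (by rw [hgram, hblock]; simp)
    linarith

/-! ### Sufficiency: covariance matrices and two-mode mixing -/

/-- A positive definite matrix is the covariance matrix of a centred Gaussian measure. -/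
theorem isBeamMatrix_of_posDef {n : ℕ} {S : Matrix (PhaseIndex n) (PhaseIndex n) ℝ}
    (hS : S.PosDef) : IsBeamMatrix S := by
  set ν := multivariateGaussian (0 : EuclideanSpace ℝ (PhaseIndex n)) S with hν
  set f : EuclideanSpace ℝ (PhaseIndex n) → (PhaseIndex n → ℝ) := fun x => x.ofLp with hf
  have hmeas : Measurable f := by fun_prop
  have hL (i : PhaseIndex n) : MemLp (fun x : EuclideanSpace ℝ (PhaseIndex n) => x i) 2 ν :=
    IsGaussian.memLp_dual ν (EuclideanSpace.proj i) 2 (by simp)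
  have hev (i : PhaseIndex n) :
      AEStronglyMeasurable (fun z : PhaseIndex n → ℝ => z i) (ν.map f) :=
    (measurable_pi_apply i).aestronglyMeasurable
  refine ⟨hS, ν.map f, Measure.isProbabilityMeasure_map hmeas.aemeasurable, fun i => ?_,
    fun i j => ?_⟩
  · rw [memLp_map_measure_iff (hev i) hmeas.aemeasurable]
    exact hL i
  · rw [covariance_map (hev i) (hev j) hmeas.aemeasurable]
    exact (covariance_eval_multivariateGaussian hS.posSemidef i j).symm

/-- Simultaneous diagonalization of `G Gᵀ` and `P` by the congruences with `m` and with its inverse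
transpose `k`. Both diagonal forms are `diag(a)`, where the `a i ^ 2` are the eigenvalues of
`Gᵀ P G`. -/
theorem exists_congr_diagonal {ι : Type*} [Fintype ι] [DecidableEq ι] {G P U : Matrix ι ι ℝ}
    {a : ι → ℝ} (ha : ∀ i, 0 < a i) (hG : IsUnit G) (hU : U * Uᵀ = 1)
    (hP : Gᵀ * P * G = U * diagonal (fun i => a i ^ 2) * Uᵀ) :
    ∃ m k : Matrix ι ι ℝ, mᵀ * k = 1 ∧ mᵀ * diagonal a * m = G * Gᵀ ∧
      kᵀ * diagonal a * k = P := by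
  obtain ⟨Gi, hGi, -⟩ := isUnit_iff_exists.mp hG
  have hsq (i : ι) : √(a i) * √(a i) = a i := Real.mul_self_sqrt (ha i).le
  have hne (i : ι) : √(a i) ≠ 0 := (Real.sqrt_pos.mpr (ha i)).ne'
  refine ⟨diagonal (fun i => (√(a i))⁻¹) * Uᵀ * Gᵀ,
    diagonal (fun i => √(a i)) * Uᵀ * Gi, ?_, ?_, ?_⟩
  · have h1 : diagonal (fun i => (√(a i))⁻¹) * diagonal (fun i => √(a i)) = (1 : Matrix ι ι ℝ) := by
      rw [diagonal_mul_diagonal, ← diagonal_one]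
      congr 1; ext i; exact inv_mul_cancel₀ (hne i)
    calc _ = G * (U * (diagonal (fun i => (√(a i))⁻¹) * diagonal (fun i => √(a i))) * Uᵀ) * Gi := by
          simp only [transpose_mul, transpose_transpose, diagonal_transpose, mul_assoc]
      _ = 1 := by rw [h1, mul_one, hU, mul_one, hGi]
  · have h1 : diagonal (fun i => (√(a i))⁻¹) * diagonal a * diagonal (fun i => (√(a i))⁻¹) =
        (1 : Matrix ι ι ℝ) := by
      rw [diagonal_mul_diagonal, diagonal_mul_diagonal, ← diagonal_one]
      congr 1; ext i
      have := hsq i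
      have := hne i
      field_simp
      nlinarith
    calc _ = G * (U * (diagonal (fun i => (√(a i))⁻¹) * diagonal a *
            diagonal (fun i => (√(a i))⁻¹)) * Uᵀ) * Gᵀ := by
          simp only [transpose_mul, transpose_transpose, diagonal_transpose, mul_assoc]
      _ = _ := by rw [h1, mul_one, hU, mul_one]
  · have h1 : diagonal (fun i => √(a i)) * diagonal a * diagonal (fun i => √(a i)) =
        diagonal fun i => a i ^ 2 := by
      rw [diagonal_mul_diagonal, diagonal_mul_diagonal]
      congr 1; ext i
      rw [mul_right_comm, hsq, sq]
    have hT : Giᵀ * Gᵀ = 1 := by rw [← transpose_mul, hGi, transpose_one]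
    calc _ = Giᵀ * (U * (diagonal (fun i => √(a i)) * diagonal a *
            diagonal (fun i => √(a i))) * Uᵀ) * Gi := by
          simp only [transpose_mul, transpose_transpose, diagonal_transpose, mul_assoc]
      _ = (Giᵀ * Gᵀ) * P * (G * Gi) := by rw [h1, ← hP]; simp only [mul_assoc]
      _ = P := by rw [hT, hGi, one_mul, mul_one]

theorem exists_orthogonal_of_trace_det {N : Matrix (Fin 2) (Fin 2) ℝ} (hN : N.IsHermitian)
    {x y : ℝ} (htr : N.trace = x + y) (hdet : N.det = x * y) :
    ∃ U : Matrix (Fin 2) (Fin 2) ℝ, U * Uᵀ = 1 ∧ N = U * diagonal ![x, y] * Uᵀ := by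
  obtain ⟨U, d, hU1, hU2, hd⟩ := exists_orthogonal_diagonalization hN
  have h1 : d 0 + d 1 = x + y := by
    rw [← htr, hd, trace_mul_comm, ← mul_assoc, hU2, one_mul, trace_diagonal, Fin.sum_univ_two]
  have h2 : d 0 * d 1 = x * y := by
    rw [← hdet, hd, det_mul_comm, ← mul_assoc, hU2, one_mul, det_diagonal, Fin.prod_univ_two]
  have h3 : (d 0 - x) * (d 0 - y) = 0 := by linear_combination d 0 * h1 - h2
  rcases mul_eq_zero.mp h3 with h | h
  · refine ⟨U, hU1, ?_⟩
    have : d = ![x, y] := by ext i; fin_cases i <;> simp <;> linarith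
    rw [← this]; exact hd
  · have hdσ : d = ![y, x] := by ext i; fin_cases i <;> simp <;> linarith
    -- Exchange the two columns of the eigenbasis.
    refine ⟨U.submatrix id (Equiv.swap 0 1), ?_, ?_⟩
    · rw [transpose_submatrix, submatrix_mul_equiv, hU1, submatrix_id_id]
    · rw [hd, hdσ]
      ext i j
      simp [Matrix.mul_apply, Fin.sum_univ_two, diagonal_apply]
      ring

theorem exists_cholesky_fin_two {a b c : ℝ} (ha : 0 < a) (h : c ^ 2 < a * b) :
    ∃ G : Matrix (Fin 2) (Fin 2) ℝ, IsUnit G ∧ G * Gᵀ = !![a, c; c, b] := by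
  have hs : 0 < √a := Real.sqrt_pos.mpr ha
  have hs2 : √a ^ 2 = a := Real.sq_sqrt ha.le
  have hr : 0 < b - c ^ 2 / a := by
    rw [sub_pos, div_lt_iff₀ ha]; linarith
  have hr2 : √(b - c ^ 2 / a) ^ 2 = b - c ^ 2 / a := Real.sq_sqrt hr.le
  refine ⟨!![√a, 0; c / √a, √(b - c ^ 2 / a)], ?_, ?_⟩
  · rw [isUnit_iff_isUnit_det, isUnit_iff_ne_zero, det_fin_two]
    simpa using ⟨hs.ne', (Real.sqrt_pos.mpr hr).ne'⟩
  · ext i j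
    fin_cases i <;> fin_cases j <;> simp [Matrix.mul_apply, Fin.sum_univ_two]
    · exact Real.mul_self_sqrt ha.le
    · field_simp
    · field_simp
    · rw [← sq, ← sq, hr2, div_pow, hs2]; ring

/-- Mixing of two degrees of freedom: `diag(a₁, a₂)`, for the positions and for the momenta, is
transformed by a symplectic matrix into matrices with the diagonal `(b₁, b₂)`. The positions get
`!![b₁, c; c, b₂]` and the momenta `!![b₁, d; d, b₂]`, where `c` and `d` are chosen such that the
product of these two matrices has the eigenvalues `a₁²` and `a₂²`. -/
theorem exists_two_mode {a₁ a₂ b₁ b₂ : ℝ} (ha₁ : 0 < a₁) (ha₂ : 0 < a₂) (hb₁ : 0 < b₁)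
    (hb₂ : 0 < b₂) (hsum : a₁ + a₂ ≤ b₁ + b₂) (hdiff : |b₁ - b₂| ≤ |a₁ - a₂|) :
    ∃ m k : Matrix (Fin 2) (Fin 2) ℝ, mᵀ * k = 1 ∧
      (∀ i, (mᵀ * diagonal ![a₁, a₂] * m) i i = ![b₁, b₂] i) ∧
      ∀ i, (kᵀ * diagonal ![a₁, a₂] * k) i i = ![b₁, b₂] i := by
  set t := (a₁ ^ 2 + a₂ ^ 2 - b₁ ^ 2 - b₂ ^ 2) / 2 with ht
  set α := a₁ * a₂ with hα
  set β := b₁ * b₂ with hβ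
  have hα0 : 0 < α := mul_pos ha₁ ha₂
  have hβ0 : 0 < β := mul_pos hb₁ hb₂
  have h1 : α ≤ β - t := by
    have : (a₁ + a₂) ^ 2 ≤ (b₁ + b₂) ^ 2 := pow_le_pow_left₀ (by positivity) hsum 2
    rw [ht, hα, hβ]; linarith
  have h2 : α ≤ β + t := by
    have := sq_le_sq.mpr hdiff
    rw [ht, hα, hβ]; linarith
  set T := (β ^ 2 + t ^ 2 - α ^ 2) / β with hT
  have hβT : β * T = β ^ 2 + t ^ 2 - α ^ 2 := by rw [hT]; field_simp
  have hTp : 0 ≤ T + 2 * t := by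
    refine nonneg_of_mul_nonneg_right (a := β) ?_ hβ0
    have : α ^ 2 ≤ (β + t) ^ 2 := pow_le_pow_left₀ hα0.le h2 2
    linarith
  have hTm : 0 ≤ T - 2 * t := by
    refine nonneg_of_mul_nonneg_right (a := β) ?_ hβ0
    have : α ^ 2 ≤ (β - t) ^ 2 := pow_le_pow_left₀ hα0.le h1 2
    linarith
  -- The trace and the determinant of the product demand `c d = t` and `c² + d² = T`.
  set c := (√(T + 2 * t) + √(T - 2 * t)) / 2 with hc
  set d := (√(T + 2 * t) - √(T - 2 * t)) / 2 with hd
  have hcd : c * d = t := by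
    rw [hc, hd]; linear_combination (Real.sq_sqrt hTp - Real.sq_sqrt hTm) / 4
  have hcd2 : c ^ 2 + d ^ 2 = T := by
    rw [hc, hd]; linear_combination (Real.sq_sqrt hTp + Real.sq_sqrt hTm) / 2
  have hprod : (β - c ^ 2) * (β - d ^ 2) = α ^ 2 := by
    linear_combination (-β) * hcd2 - hβT + (c * d + t) * hcd
  have hc2 : c ^ 2 < β := by
    by_contra! hle
    have hd2 : β ≤ d ^ 2 := by
      by_contra! hlt
      have := mul_nonpos_of_nonpos_of_nonneg (sub_nonpos.mpr hle) (sub_pos.mpr hlt).le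
      have := pow_pos hα0 2
      linarith
    have h3 : β ^ 2 ≤ t ^ 2 := by
      calc β ^ 2 = β * β := sq β
        _ ≤ c ^ 2 * d ^ 2 := mul_le_mul hle hd2 hβ0.le (sq_nonneg c)
        _ = t ^ 2 := by rw [← mul_pow, hcd]
    have h4 : |t| < β := abs_lt.mpr ⟨by linarith, by linarith⟩
    have := sq_lt_sq' (by linarith [neg_abs_le t]) h4
    rw [sq_abs] at this
    linarith
  obtain ⟨G, hG, hGG⟩ := exists_cholesky_fin_two hb₁ hc2
  set P : Matrix (Fin 2) (Fin 2) ℝ := !![b₁, d; d, b₂] with hP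
  have hN : (Gᵀ * P * G).IsHermitian := by
    have : Pᵀ = P := by ext i j; fin_cases i <;> fin_cases j <;> rfl
    simp [IsHermitian, transpose_mul, this, mul_assoc]
  obtain ⟨U, hU, hNU⟩ := exists_orthogonal_of_trace_det hN (x := a₁ ^ 2) (y := a₂ ^ 2)
    (by
      rw [trace_mul_comm, ← mul_assoc, hGG, trace_fin_two]
      simp [hP, Matrix.mul_apply, Fin.sum_univ_two]
      linear_combination 2 * hcd + 2 * ht)
    (by
      rw [det_mul_comm, ← mul_assoc, hGG, det_mul, det_fin_two, det_fin_two]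
      simp [hP]
      linear_combination hprod)
  obtain ⟨m, k, hmk, hm, hk⟩ := exists_congr_diagonal (a := ![a₁, a₂]) (G := G) (P := P) (U := U)
    (by intro i; fin_cases i <;> simpa) hG hU (by
      rw [hNU]; congr 3; ext i; fin_cases i <;> simp)
  refine ⟨m, k, hmk, fun i => ?_, fun i => ?_⟩
  · rw [hm, hGG]; fin_cases i <;> simp
  · rw [hk]; fin_cases i <;> simp [hP]

/-- `ε` arises from `e` by a symplectic congruence that does not mix positions and momenta: it acts
by `m` on the positions and by the inverse transpose `k` of `m` on the momenta, and it turns `diag(e)`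
into matrices with the diagonal `ε`. -/
def Realizable (e ε : Fin 3 → ℝ) : Prop :=
  ∃ m k : Matrix (Fin 3) (Fin 3) ℝ, mᵀ * k = 1 ∧
    (∀ i, (mᵀ * diagonal e * m) i i = ε i) ∧ ∀ i, (kᵀ * diagonal e * k) i i = ε i

theorem Realizable.permute {e ε : Fin 3 → ℝ} (h : Realizable e ε) (σ : Equiv.Perm (Fin 3)) :
    Realizable e (ε ∘ σ) := by
  obtain ⟨m, k, hmk, hm, hk⟩ := h
  refine ⟨m.submatrix id σ, k.submatrix id σ, ?_, fun i => ?_, fun i => ?_⟩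
  · have : (m.submatrix id σ)ᵀ * k.submatrix id σ = (mᵀ * k).submatrix σ σ := by
      ext i j; simp [Matrix.mul_apply]
    rw [this, hmk, submatrix_one_equiv]
  · rw [Function.comp_apply, ← hm]; simp [Matrix.mul_apply]
  · rw [Function.comp_apply, ← hk]; simp [Matrix.mul_apply]

theorem Realizable.permute_left {e ε : Fin 3 → ℝ} (σ : Equiv.Perm (Fin 3))
    (h : Realizable (e ∘ σ) ε) : Realizable e ε := by
  obtain ⟨m, k, hmk, hm, hk⟩ := h
  have hT (x y : Matrix (Fin 3) (Fin 3) ℝ) :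
      (x.submatrix σ.symm id)ᵀ * y.submatrix σ.symm id = xᵀ * y := by
    ext i j
    simp only [Matrix.mul_apply, transpose_apply, submatrix_apply, id]
    exact Equiv.sum_comp σ.symm fun l => x l i * y l j
  have hD (x : Matrix (Fin 3) (Fin 3) ℝ) : diagonal e * x.submatrix σ.symm id =
      (diagonal (e ∘ σ) * x).submatrix σ.symm id := by
    ext i j; simp
  exact ⟨m.submatrix σ.symm id, k.submatrix σ.symm id, by rw [hT, hmk],
    fun i => by rw [mul_assoc, hD, hT, ← mul_assoc, hm],
    fun i => by rw [mul_assoc, hD, hT, ← mul_assoc, hk]⟩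

/-- After the first two degrees of freedom have been mixed, the second one is still uncorrelated
with the third, so these two can be mixed again without changing the first emittance. -/
theorem realizable_of_two_steps {a₁ a₂ a₃ b ε₁ ε₂ ε₃ : ℝ} (ha₁ : 0 < a₁) (ha₂ : 0 < a₂)
    (ha₃ : 0 < a₃) (hb : 0 < b) (hε₁ : 0 < ε₁) (hε₂ : 0 < ε₂) (hε₃ : 0 < ε₃)
    (hsum : a₁ + a₂ ≤ ε₁ + b) (hdiff : |ε₁ - b| ≤ |a₁ - a₂|)
    (hsum' : b + a₃ ≤ ε₂ + ε₃) (hdiff' : |ε₂ - ε₃| ≤ |b - a₃|) :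
    Realizable ![a₁, a₂, a₃] ![ε₁, ε₂, ε₃] := by
  obtain ⟨m, k, hmk, hm, hk⟩ := exists_two_mode ha₁ ha₂ hε₁ hb hsum hdiff
  obtain ⟨m', k', hmk', hm', hk'⟩ := exists_two_mode hb ha₃ hε₂ hε₃ hsum' hdiff'
  set X : Matrix (Fin 2) (Fin 2) ℝ → Matrix (Fin 3) (Fin 3) ℝ := fun x =>
    !![x 0 0, x 0 1, 0; x 1 0, x 1 1, 0; 0, 0, 1]
  set Y : Matrix (Fin 2) (Fin 2) ℝ → Matrix (Fin 3) (Fin 3) ℝ := fun x =>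
    !![1, 0, 0; 0, x 0 0, x 0 1; 0, x 1 0, x 1 1]
  have key (x y : Matrix (Fin 2) (Fin 2) ℝ)
      (hx : ∀ i, (xᵀ * diagonal ![a₁, a₂] * x) i i = ![ε₁, b] i)
      (hy : ∀ i, (yᵀ * diagonal ![b, a₃] * y) i i = ![ε₂, ε₃] i) (i : Fin 3) :
      ((X x * Y y)ᵀ * diagonal ![a₁, a₂, a₃] * (X x * Y y)) i i = ![ε₁, ε₂, ε₃] i := by
    have hx0 := hx 0
    have hx1 := hx 1
    have hy0 := hy 0
    have hy1 := hy 1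
    simp [Matrix.mul_apply, Fin.sum_univ_two, diagonal_apply] at hx0 hx1 hy0 hy1
    fin_cases i <;> simp [X, Y, Matrix.mul_apply, Fin.sum_univ_three, diagonal_apply]
    · linear_combination hx0
    · linear_combination y 0 0 ^ 2 * hx1 + hy0
    · linear_combination y 0 1 ^ 2 * hx1 + hy1
  refine ⟨X m * Y m', X k * Y k', ?_, key m m' hm hm', key k k' hk hk'⟩
  have h1 : (X m)ᵀ * X k = 1 := by
    have h (i j) := congrFun (congrFun hmk i) j
    have h00 := h 0 0
    have h01 := h 0 1
    have h10 := h 1 0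
    have h11 := h 1 1
    simp [Matrix.mul_apply, Fin.sum_univ_two] at h00 h01 h10 h11
    ext i j
    fin_cases i <;> fin_cases j <;> simp [X, Matrix.mul_apply, Fin.sum_univ_three, *]
  have h2 : (Y m')ᵀ * Y k' = 1 := by
    have h (i j) := congrFun (congrFun hmk' i) j
    have h00 := h 0 0
    have h01 := h 0 1
    have h10 := h 1 0
    have h11 := h 1 1
    simp [Matrix.mul_apply, Fin.sum_univ_two] at h00 h01 h10 h11
    ext i j
    fin_cases i <;> fin_cases j <;> simp [Y, Matrix.mul_apply, Fin.sum_univ_three, *]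
  rw [transpose_mul, mul_assoc, ← mul_assoc (X m)ᵀ, h1, one_mul, h2]

/-- The two-step mixing always succeeds. If `e₂ ≤ ε₂`, the degrees of freedom `e₁, e₃` are mixed
into `ε₁, b`, and then `b, e₂` into `ε₂, ε₃`. If `ε₂ < e₂`, then `e₁, e₂` are mixed into `ε₁, b`, and
`b, e₃` into `ε₂, ε₃`. -/
theorem realizable_of_ordered {e₁ e₂ e₃ ε₁ ε₂ ε₃ : ℝ} (he₁ : 0 < e₁) (he₁₂ : e₁ ≤ e₂)
    (he₂₃ : e₂ ≤ e₃) (hε₁₂ : ε₁ ≤ ε₂) (hε₂₃ : ε₂ ≤ ε₃) (hmin : e₁ ≤ ε₁)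
    (hsum : e₁ + e₂ + e₃ ≤ ε₁ + ε₂ + ε₃) (hmax : e₁ + e₂ - e₃ ≤ ε₁ + ε₂ - ε₃) :
    Realizable ![e₁, e₂, e₃] ![ε₁, ε₂, ε₃] := by
  rcases le_or_gt e₂ ε₂ with h | h
  -- In both cases `b` is the largest value that the upper bounds on it permit.
  · set b := min (ε₁ + e₃ - e₁) (ε₂ + ε₃ - e₂) with hb
    have hb1 : b ≤ ε₁ + e₃ - e₁ := min_le_left _ _
    have hb2 : b ≤ ε₂ + ε₃ - e₂ := min_le_right _ _
    have hb3 : e₁ + e₃ - ε₁ ≤ b := le_min (by linarith) (by linarith)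
    have hb4 : ε₁ - e₃ + e₁ ≤ b := le_min (by linarith) (by linarith)
    have hb5 : e₂ + ε₃ - ε₂ ≤ b := le_min (by linarith) (by linarith)
    refine Realizable.permute_left (Equiv.swap 1 2) ?_
    have : ![e₁, e₂, e₃] ∘ Equiv.swap (1 : Fin 3) 2 = ![e₁, e₃, e₂] := by
      ext i; fin_cases i <;> simp [Equiv.swap_apply_def]
    rw [this]
    apply realizable_of_two_steps (b := b) <;> try linarith
    · rw [abs_le, abs_of_nonpos (by linarith : e₁ - e₃ ≤ 0)]; constructor <;> linarith
    · rw [abs_le, abs_of_nonneg (by linarith : 0 ≤ b - e₂)]; constructor <;> linarith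
  · set b := min (ε₁ + e₂ - e₁) (min (ε₂ + ε₃ - e₃) (e₃ - ε₃ + ε₂)) with hb
    have hb1 : b ≤ ε₁ + e₂ - e₁ := min_le_left _ _
    have hb2 : b ≤ ε₂ + ε₃ - e₃ := (min_le_right _ _).trans (min_le_left _ _)
    have hb3 : b ≤ e₃ - ε₃ + ε₂ := (min_le_right _ _).trans (min_le_right _ _)
    have hb4 : e₁ + e₂ - ε₁ ≤ b := le_min (by linarith) (le_min (by linarith) (by linarith))
    have hb5 : ε₁ - e₂ + e₁ ≤ b := le_min (by linarith) (le_min (by linarith) (by linarith))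
    apply realizable_of_two_steps (b := b) <;> try linarith
    · rw [abs_le, abs_of_nonpos (by linarith : e₁ - e₂ ≤ 0)]; constructor <;> linarith
    · rw [abs_le, abs_of_nonpos (by linarith : b - e₃ ≤ 0)]; constructor <;> linarith


/-! ### Eigenemittances of the constructed matrices -/

open Polynomial in
theorem charpoly_diagonal_mul_symplecticUnit {n : ℕ} (e : Fin n → ℝ) :
    (diagonal (fun i : PhaseIndex n => e i.1) * symplecticUnit n).charpoly =
      ∏ m, (X ^ 2 + C (e m ^ 2)) := by
  have h1 : diagonal (fun i : PhaseIndex n => e i.1) * symplecticUnit n =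
      Matrix.reindex (Equiv.prodComm _ _) (Equiv.prodComm _ _)
        (blockDiagonal fun m => (!![0, e m; -e m, 0] : Matrix (Fin 2) (Fin 2) ℝ)) := by
    ext ⟨m, a⟩ ⟨k, b⟩
    by_cases h : m = k
    · subst h
      fin_cases a <;> fin_cases b <;> simp [symplecticUnit, blockDiagonal_apply]
    · simp [symplecticUnit, blockDiagonal_apply, h]
  have h2 : (blockDiagonal fun m => (!![0, e m; -e m, 0] : Matrix (Fin 2) (Fin 2) ℝ)).charmatrix =
      blockDiagonal fun m => (!![0, e m; -e m, 0] : Matrix (Fin 2) (Fin 2) ℝ).charmatrix := by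
    ext1 ⟨a, m⟩ ⟨b, k⟩
    by_cases h : m = k
    · subst h
      simp [charmatrix_apply, blockDiagonal_apply, diagonal_apply]
    · simp [blockDiagonal_apply, h]
  rw [h1, charpoly_reindex, Matrix.charpoly, h2, det_blockDiagonal]
  refine Finset.prod_congr rfl fun m _ => ?_
  rw [det_fin_two]
  simp
  ring

open Polynomial in
theorem isEigenemittances_of_charpoly {n : ℕ} {S : Matrix (PhaseIndex n) (PhaseIndex n) ℝ}
    {e : Fin n → ℝ} (he : ∀ m, 0 < e m)
    (hS : (S * symplecticUnit n).charpoly = ∏ m, (X ^ 2 + C (e m ^ 2))) :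
    IsEigenemittances S e := by
  refine ⟨he, ?_⟩
  rw [charpoly_map, hS, ← roots_prod_X_sub_C_pairs, Polynomial.map_prod]
  congr 1
  refine Finset.prod_congr rfl fun m _ => ?_
  have h : (C (Complex.I * (e m : ℂ))) * C (Complex.I * (e m : ℂ)) = - C ((e m : ℂ) ^ 2) := by
    rw [← C_mul, ← C_neg]; congr 1
    linear_combination (e m : ℂ) ^ 2 * Complex.I_mul_I
  simp only [Polynomial.map_add, Polynomial.map_pow, map_X, map_C, C_neg]
  have h' : (algebraMap ℝ ℂ) (e m ^ 2) = (e m : ℂ) ^ 2 := by simp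
  rw [h']
  linear_combination h

/-- The matrix `S` is `mᵀ diag(e) m` on the positions and `kᵀ diag(e) k` on the momenta. It is
symplectically congruent to `diag(e)` in both, so its eigenemittances are `e`. -/
theorem Realizable.exists_beamMatrix {e ε : Fin 3 → ℝ} (he : ∀ m, 0 < e m) (hε : ∀ m, 0 < ε m)
    (h : Realizable e ε) :
    ∃ S : Matrix (PhaseIndex 3) (PhaseIndex 3) ℝ, IsBeamMatrix S ∧
      (∀ m, projectedEmittance S m = ε m) ∧ IsEigenemittances S e := by
  obtain ⟨m, k, hmk, hm, hk⟩ := h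
  have hkm : m * kᵀ = 1 := by
    have := congrArg transpose hmk
    rw [transpose_mul, transpose_transpose, transpose_one] at this
    exact mul_eq_one_comm.mp this
  set M : Matrix (PhaseIndex 3) (PhaseIndex 3) ℝ :=
    m ⊗ₖ !![1, 0; 0, 0] + k ⊗ₖ !![0, 0; 0, 1] with hM
  set D : Matrix (PhaseIndex 3) (PhaseIndex 3) ℝ := diagonal fun i => e i.1 with hD
  have hMJ : M * symplecticUnit 3 * Mᵀ = symplecticUnit 3 := by
    have hmk' : k * mᵀ = 1 := by
      have := congrArg transpose hkm
      rwa [transpose_mul, transpose_transpose, transpose_one] at this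
    have hq : (!![1, 0; 0, 0] : Matrix (Fin 2) (Fin 2) ℝ)ᵀ = !![1, 0; 0, 0] := by
      ext a b; fin_cases a <;> fin_cases b <;> rfl
    have hp : (!![0, 0; 0, 1] : Matrix (Fin 2) (Fin 2) ℝ)ᵀ = !![0, 0; 0, 1] := by
      ext a b; fin_cases a <;> fin_cases b <;> rfl
    rw [hM, symplecticUnit, transpose_add, ← kroneckerMap_transpose, ← kroneckerMap_transpose,
      hq, hp]
    simp only [add_mul, mul_add, ← mul_kronecker_mul, mul_one, hkm, hmk']
    ext ⟨i, a⟩ ⟨j, b⟩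
    fin_cases a <;> fin_cases b <;> simp
  have hMinj : Function.Injective M.mulVec := by
    refine mulVec_injective_of_isUnit ?_
    rw [isUnit_iff_isUnit_det, isUnit_iff_ne_zero]
    intro h0
    have h1 := congrArg det hMJ
    have h2 := congrArg det (symplecticUnit_mul_self 3)
    rw [det_mul, det_mul, h0, zero_mul, zero_mul] at h1
    rw [det_mul, ← h1, zero_mul, det_neg, det_one, mul_one] at h2
    exact pow_ne_zero _ (by norm_num) h2.symm
  have hDpos : D.PosDef := posDef_diagonal_iff.mpr fun i => he i.1
  have hblock (i j : Fin 3) (a b : Fin 2) : (Mᵀ * D * M) (i, a) (j, b) =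
      if a = b then (if a = 0 then (mᵀ * diagonal e * m) i j else (kᵀ * diagonal e * k) i j)
      else 0 := by
    fin_cases a <;> fin_cases b <;>
      simp [hM, hD, Matrix.mul_apply, Fintype.sum_prod_type, diagonal_apply]
  refine ⟨Mᵀ * D * M, isBeamMatrix_of_posDef ?_, fun i => ?_, isEigenemittances_of_charpoly he ?_⟩
  · simpa using hDpos.conjTranspose_mul_mul_same hMinj
  · rw [projectedEmittance, det_fin_two]
    simp only [beamBlock, of_apply, hblock]
    simp [hm, hk, Real.sqrt_mul_self (hε i).le]
  · rw [charpoly_symplectic_congr hMJ, charpoly_diagonal_mul_symplecticUnit]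

/-! ### Three degrees of freedom -/

theorem proposition4 (ε₁ ε₂ ε₃ e_min e_mid e_max : ℝ)
    (hε₁ : 0 < ε₁) (hε₂ : 0 < ε₂) (hε₃ : 0 < ε₃)
    (he_min : 0 < e_min) (he_mid : e_min ≤ e_mid) (he_max : e_mid ≤ e_max) :
    (∃ S : Matrix (PhaseIndex 3) (PhaseIndex 3) ℝ,
        IsBeamMatrix S ∧
        projectedEmittance S 0 = ε₁ ∧ projectedEmittance S 1 = ε₂ ∧
        projectedEmittance S 2 = ε₃ ∧
        IsEigenemittances S ![e_min, e_mid, e_max]) ↔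
      (ε₁ + ε₂ - ε₃ ≥ e_min + e_mid - e_max ∧
        ε₁ - ε₂ + ε₃ ≥ e_min + e_mid - e_max ∧
        -ε₁ + ε₂ + ε₃ ≥ e_min + e_mid - e_max ∧
        ε₁ + ε₂ + ε₃ ≥ e_min + e_mid + e_max ∧
        min ε₁ (min ε₂ ε₃) ≥ e_min) := by
  constructor
  · rintro ⟨S, hS, h0, h1, h2, he⟩
    have key := emittance_inequalities hS.1 he he_min (hi := e_max)
      (by intro m; fin_cases m <;> simp <;> linarith)
      (by intro m; fin_cases m <;> simp <;> linarith)
    obtain ⟨hsum, hm⟩ := key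
    have k0 := hm 0
    have k1 := hm 1
    have k2 := hm 2
    simp only [Fin.sum_univ_three, h0, h1, h2, Matrix.cons_val] at hsum k0 k1 k2
    refine ⟨by linarith, by linarith, by linarith, by linarith,
      le_min k0.1 (le_min k1.1 k2.1)⟩
  · rintro ⟨h3, h2, h1, hsum, hmin⟩
    have hmin1 : e_min ≤ ε₁ := hmin.trans (min_le_left _ _)
    have hmin2 : e_min ≤ ε₂ := hmin.trans ((min_le_right _ _).trans (min_le_left _ _))
    have hmin3 : e_min ≤ ε₃ := hmin.trans ((min_le_right _ _).trans (min_le_right _ _))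
    set ε : Fin 3 → ℝ := ![ε₁, ε₂, ε₃] with hε
    have hεpos (m : Fin 3) : 0 < ε m := by fin_cases m <;> simpa [hε]
    have hεmin (m : Fin 3) : e_min ≤ ε m := by fin_cases m <;> simpa [hε]
    have hεsum : ∑ m, ε m = ε₁ + ε₂ + ε₃ := by simp [hε, Fin.sum_univ_three]
    have hεmax (m : Fin 3) : e_min + e_mid - e_max ≤ ∑ k, ε k - 2 * ε m := by
      rw [hεsum]; fin_cases m <;> simp [hε] <;> linarith
    -- The inequalities are symmetric in the emittances, which may therefore be sorted.
    set σ := Tuple.sort ε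
    have hmono : Monotone (ε ∘ σ) := Tuple.monotone_sort ε
    have hσsum : ε (σ 0) + ε (σ 1) + ε (σ 2) = ∑ m, ε m := by
      rw [← Equiv.sum_comp σ ε, Fin.sum_univ_three]
    have hmax := hεmax (σ 2)
    have hreal : Realizable ![e_min, e_mid, e_max] ![ε (σ 0), ε (σ 1), ε (σ 2)] :=
      realizable_of_ordered he_min he_mid he_max (hmono (by decide)) (hmono (by decide))
        (hεmin _) (by linarith) (by linarith)
    have hreal' := hreal.permute σ.symm
    have hcomp : ![ε (σ 0), ε (σ 1), ε (σ 2)] ∘ σ.symm = ε := by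
      have : ![ε (σ 0), ε (σ 1), ε (σ 2)] = ε ∘ σ := by
        ext i; fin_cases i <;> rfl
      rw [this, Function.comp_assoc, Equiv.self_comp_symm, Function.comp_id]
    rw [hcomp] at hreal'
    obtain ⟨S, hS, hproj, heig⟩ := hreal'.exists_beamMatrix
      (by intro m; fin_cases m <;> simp <;> linarith) hεpos
    exact ⟨S, hS, hproj 0, hproj 1, hproj 2, heig⟩
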